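/- Let $P_n,Q_n\in\mathbb{R}[x]$ be the derivative polynomials for tangent and secant and $\widetilde P_n,\widetilde Q_n\in\mathbb{R}[x]$ those for the hyperbolic tangent and hyperbolic secant, i.e. the unique polynomials with $$\frac{d^n}{d\theta^n}\tan\theta=P_n(\tan\theta),\quad \frac{d^n}{d\theta^n}\sec\theta=\sec\theta\,Q_n(\tan\theta),$$ $$\frac{d^n}{d\theta^n}\tanh\theta=\widetilde P_n(\tanh\theta),\quad \frac{d^n}{d\theta^n}\operatorname{sech}\theta=\operatorname{sech}\theta\,\widetilde Q_n(\tanh\theta).$$ The alternating derivative polynomials are $$p_n(x)=(-1)^n\widetilde P_n(x)=(-1)^n\mathrm{i}^{\,n-1}P_n(\mathrm{i}x),\qquad q_n(x)=(-1)^n2^n\widetilde Q_n(x)=(-1)^n2^n\mathrm{i}^{\,n}Q_n(\mathrm{i}x).$$ For a permutation $\pi$ of $\{1,\dots,n\}$ put $\pi(0)=\pi(n+1)=0$. An index $i\in\{1,\dots,n\}$ is a peak of $\pi$ if $\pi(i-1)<\pi(i)>\pi(i+1)$, and a double descent of $\pi$ if $\pi(i-1)>\pi(i)>\pi(i+1)$.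 Let $a(n,k)$ be the number of permutations of $\{1,\dots,n\}$ with exactly $k$ peaks and no double descents, and let $b(n,k)$ be the number of permutations of $\{1,\dots,n\}$ for which exactly $k$ indices $i\in\{1,\dots,n-1\}$ satisfy $\pi(i-1)<\pi(i)>\pi(i+1)$. Then for every $n\ge 1$, as polynomials in $x$, $$p_n(x)=\sum_{k=1}^{\lfloor (n+1)/2\rfloor}a(n,k)\,(x^2-1)^k(2x)^{n+1-2k},$$ $$q_n(x)=\sum_{k=0}^{\lfloor n/2\rfloor}4^k\,b(n,k)\,(x^2-1)^k(2x)^{n-2k}.$$ -/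

import Mathlib

open Polynomial

/-! ### Derivative polynomials of the tangent and the secant -/

/-- `P` is the `n`-th derivative polynomial for tangent:
`dⁿ/dθⁿ tan θ = P (tan θ)` wherever the tangent is defined. -/
def IsTanDerivPoly (n : ℕ) (P : ℝ[X]) : Prop :=
  ∀ θ : ℝ, Real.cos θ ≠ 0 → iteratedDeriv n Real.tan θ = P.eval (Real.tan θ)

/-- `Q` is the `n`-th derivative polynomial for secant:
`dⁿ/dθⁿ sec θ = sec θ * Q (tan θ)` wherever the secant is defined. -/
def IsSecDerivPoly (n : ℕ) (Q : ℝ[X]) : Prop :=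
  ∀ θ : ℝ, Real.cos θ ≠ 0 →
    iteratedDeriv n (fun t : ℝ => (Real.cos t)⁻¹) θ = (Real.cos θ)⁻¹ * Q.eval (Real.tan θ)

/-! ### Derivative polynomials of the hyperbolic tangent and the hyperbolic secant -/

/-- `P` is the `n`-th derivative polynomial for the hyperbolic tangent:
`dⁿ/dθⁿ tanh θ = P (tanh θ)` for all real `θ`. -/
def IsTanhDerivPoly (n : ℕ) (P : ℝ[X]) : Prop :=
  ∀ θ : ℝ, iteratedDeriv n Real.tanh θ = P.eval (Real.tanh θ)

/-- `Q` is the `n`-th derivative polynomial for the hyperbolic secant `sech = 1 / cosh`: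
`dⁿ/dθⁿ sech θ = sech θ * Q (tanh θ)` for all real `θ`. -/
def IsSechDerivPoly (n : ℕ) (Q : ℝ[X]) : Prop :=
  ∀ θ : ℝ,
    iteratedDeriv n (fun t : ℝ => (Real.cosh t)⁻¹) θ = (Real.cosh θ)⁻¹ * Q.eval (Real.tanh θ)

theorem hasDerivAt_tanh_aux (θ : ℝ) : HasDerivAt Real.tanh (1 - Real.tanh θ ^ 2) θ := by
  have hc : Real.cosh θ ≠ 0 := (Real.cosh_pos θ).ne'
  have h := (Real.hasDerivAt_sinh θ).div (Real.hasDerivAt_cosh θ) hc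
  have he : Real.tanh = Real.sinh / Real.cosh := by
    funext t; exact Real.tanh_eq_sinh_div_cosh t
  rw [he]
  refine h.congr_deriv ?_
  rw [Pi.div_apply]
  field_simp

theorem hasDerivAt_sech_aux (θ : ℝ) :
    HasDerivAt (fun t : ℝ => (Real.cosh t)⁻¹) (-((Real.cosh θ)⁻¹ * Real.tanh θ)) θ := by
  have hc : Real.cosh θ ≠ 0 := (Real.cosh_pos θ).ne'
  have h := (Real.hasDerivAt_cosh θ).inv hc
  refine h.congr_deriv ?_
  rw [Real.tanh_eq_sinh_div_cosh]
  field_simp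

theorem hasDerivAt_tan_aux {θ : ℝ} (hc : Real.cos θ ≠ 0) :
    HasDerivAt Real.tan (1 + Real.tan θ ^ 2) θ := by
  refine (Real.hasDerivAt_tan hc).congr_deriv ?_
  have := Real.sin_sq_add_cos_sq θ
  rw [Real.tan_eq_sin_div_cos]
  field_simp
  linarith

theorem hasDerivAt_sec_aux {θ : ℝ} (hc : Real.cos θ ≠ 0) :
    HasDerivAt (fun t : ℝ => (Real.cos t)⁻¹) ((Real.cos θ)⁻¹ * Real.tan θ) θ := by
  refine ((Real.hasDerivAt_cos θ).inv hc).congr_deriv ?_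
  rw [Real.tan_eq_sin_div_cos]
  field_simp

theorem IsTanhDerivPoly.succ {n : ℕ} {P : ℝ[X]} (h : IsTanhDerivPoly n P) :
    IsTanhDerivPoly (n + 1) ((1 - X ^ 2) * derivative P) := by
  intro θ
  have hf : iteratedDeriv n Real.tanh = fun t => P.eval (Real.tanh t) := funext h
  rw [iteratedDeriv_succ, hf]
  have := (P.hasDerivAt (Real.tanh θ)).comp θ (hasDerivAt_tanh_aux θ)
  rw [show (fun t => P.eval (Real.tanh t)) = (fun x => P.eval x) ∘ Real.tanh from rfl,
    this.deriv]
  simp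
  ring

theorem IsSechDerivPoly.succ {n : ℕ} {Q : ℝ[X]} (h : IsSechDerivPoly n Q) :
    IsSechDerivPoly (n + 1) ((1 - X ^ 2) * derivative Q - X * Q) := by
  intro θ
  have hf : iteratedDeriv n (fun t : ℝ => (Real.cosh t)⁻¹) =
      fun t => (Real.cosh t)⁻¹ * Q.eval (Real.tanh t) := funext h
  rw [iteratedDeriv_succ, hf]
  have h1 := (Q.hasDerivAt (Real.tanh θ)).comp θ (hasDerivAt_tanh_aux θ)
  have h2 := (hasDerivAt_sech_aux θ).mul h1
  refine h2.deriv.trans ?_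
  simp
  ring

theorem IsTanDerivPoly.succ {n : ℕ} {P : ℝ[X]} (h : IsTanDerivPoly n P) :
    IsTanDerivPoly (n + 1) ((1 + X ^ 2) * derivative P) := by
  intro θ hθ
  have hf : iteratedDeriv n Real.tan =ᶠ[nhds θ] fun t => P.eval (Real.tan t) := by
    filter_upwards [Real.continuous_cos.continuousAt.eventually_ne hθ] with t ht using h t ht
  rw [iteratedDeriv_succ, hf.deriv_eq]
  have := (P.hasDerivAt (Real.tan θ)).comp θ (hasDerivAt_tan_aux hθ)
  refine this.deriv.trans ?_
  simp
  ring

theorem IsSecDerivPoly.succ {n : ℕ} {Q : ℝ[X]} (h : IsSecDerivPoly n Q) :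
    IsSecDerivPoly (n + 1) ((1 + X ^ 2) * derivative Q + X * Q) := by
  intro θ hθ
  have hf : iteratedDeriv n (fun t : ℝ => (Real.cos t)⁻¹) =ᶠ[nhds θ]
      fun t => (Real.cos t)⁻¹ * Q.eval (Real.tan t) := by
    filter_upwards [Real.continuous_cos.continuousAt.eventually_ne hθ] with t ht using h t ht
  rw [iteratedDeriv_succ, hf.deriv_eq]
  have h1 := (Q.hasDerivAt (Real.tan θ)).comp θ (hasDerivAt_tan_aux hθ)
  have h2 := (hasDerivAt_sec_aux hθ).mul h1
  refine h2.deriv.trans ?_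
  simp
  ring

theorem exists_isTanhDerivPoly (n : ℕ) : ∃ P, IsTanhDerivPoly n P := by
  induction n with
  | zero => exact ⟨X, fun θ => by simp⟩
  | succ n ih => exact ih.elim fun P h => ⟨_, h.succ⟩

theorem exists_isSechDerivPoly (n : ℕ) : ∃ Q, IsSechDerivPoly n Q := by
  induction n with
  | zero => exact ⟨1, fun θ => by simp⟩
  | succ n ih => exact ih.elim fun Q h => ⟨_, h.succ⟩

theorem exists_isTanDerivPoly (n : ℕ) : ∃ P, IsTanDerivPoly n P := by
  induction n with
  | zero => exact ⟨X, fun θ _ => by simp⟩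
  | succ n ih => exact ih.elim fun P h => ⟨_, h.succ⟩

theorem exists_isSecDerivPoly (n : ℕ) : ∃ Q, IsSecDerivPoly n Q := by
  induction n with
  | zero => exact ⟨1, fun θ _ => by simp⟩
  | succ n ih => exact ih.elim fun Q h => ⟨_, h.succ⟩

theorem IsTanhDerivPoly.unique {n : ℕ} {P P' : ℝ[X]} (h : IsTanhDerivPoly n P)
    (h' : IsTanhDerivPoly n P') : P = P' :=
  Polynomial.eq_of_infinite_eval_eq _ _ <|
    (Set.infinite_range_of_injective Real.tanh_injective).mono <| by
      rintro _ ⟨θ, rfl⟩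
      exact (h θ).symm.trans (h' θ)

theorem IsSechDerivPoly.unique {n : ℕ} {Q Q' : ℝ[X]} (h : IsSechDerivPoly n Q)
    (h' : IsSechDerivPoly n Q') : Q = Q' :=
  Polynomial.eq_of_infinite_eval_eq _ _ <|
    (Set.infinite_range_of_injective Real.tanh_injective).mono <| by
      rintro _ ⟨θ, rfl⟩
      exact mul_left_cancel₀ (inv_ne_zero (Real.cosh_pos θ).ne') ((h θ).symm.trans (h' θ))

theorem IsTanDerivPoly.unique {n : ℕ} {P P' : ℝ[X]} (h : IsTanDerivPoly n P)
    (h' : IsTanDerivPoly n P') : P = P' := by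
  refine Polynomial.funext fun x => ?_
  have hc := (Real.cos_arctan_pos x).ne'
  simpa using (h _ hc).symm.trans (h' _ hc)

theorem IsSecDerivPoly.unique {n : ℕ} {Q Q' : ℝ[X]} (h : IsSecDerivPoly n Q)
    (h' : IsSecDerivPoly n Q') : Q = Q' := by
  refine Polynomial.funext fun x => ?_
  have hc := (Real.cos_arctan_pos x).ne'
  have := mul_left_cancel₀ (inv_ne_zero hc) ((h _ hc).symm.trans (h' _ hc))
  simpa using this

/-- The derivative polynomials `P_n` for tangent (the unique ones, by `IsTanDerivPoly.unique`). -/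
noncomputable def tanDerivPoly (n : ℕ) : ℝ[X] := (exists_isTanDerivPoly n).choose

/-- The derivative polynomials `Q_n` for secant (the unique ones, by `IsSecDerivPoly.unique`). -/
noncomputable def secDerivPoly (n : ℕ) : ℝ[X] := (exists_isSecDerivPoly n).choose

/-- The derivative polynomials for the hyperbolic tangent
(the unique ones, by `IsTanhDerivPoly.unique`). -/
noncomputable def tanhDerivPoly (n : ℕ) : ℝ[X] := (exists_isTanhDerivPoly n).choose

/-- The derivative polynomials for the hyperbolic secant
(the unique ones, by `IsSechDerivPoly.unique`). -/
noncomputable def sechDerivPoly (n : ℕ) : ℝ[X] := (exists_isSechDerivPoly n).choose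

theorem tanDerivPoly_spec (n : ℕ) : IsTanDerivPoly n (tanDerivPoly n) :=
  (exists_isTanDerivPoly n).choose_spec

theorem secDerivPoly_spec (n : ℕ) : IsSecDerivPoly n (secDerivPoly n) :=
  (exists_isSecDerivPoly n).choose_spec

theorem tanhDerivPoly_spec (n : ℕ) : IsTanhDerivPoly n (tanhDerivPoly n) :=
  (exists_isTanhDerivPoly n).choose_spec

theorem sechDerivPoly_spec (n : ℕ) : IsSechDerivPoly n (sechDerivPoly n) :=
  (exists_isSechDerivPoly n).choose_spec

/-! ### Alternating derivative polynomials -/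

/-- The alternating derivative polynomial `p_n` for tangent: `(-1)ⁿ` times the `n`-th derivative
polynomial for the hyperbolic tangent. Equivalently `p_n(x) = (-1)ⁿ iⁿ⁻¹ P_n(i x)`, see
`altTanPoly_eq_tan`. -/
noncomputable def altTanPoly (n : ℕ) : ℝ[X] := (-1) ^ n * tanhDerivPoly n

/-- The alternating derivative polynomial `q_n` for secant: `(-1)ⁿ 2ⁿ` times the `n`-th derivative
polynomial for the hyperbolic secant. Equivalently `q_n(x) = (-1)ⁿ 2ⁿ iⁿ Q_n(i x)`, see
`altSecPoly_eq_sec`. -/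
noncomputable def altSecPoly (n : ℕ) : ℝ[X] := (-1) ^ n * 2 ^ n * sechDerivPoly n

/-- The second description of `p_n`, through the derivative polynomials for the tangent. -/
theorem altTanPoly_eq_tan (n : ℕ) :
    (altTanPoly n).map (algebraMap ℝ ℂ) =
      C ((-1) ^ n * Complex.I ^ ((n : ℤ) - 1)) *
        ((tanDerivPoly n).map (algebraMap ℝ ℂ)).comp (C Complex.I * X) := by
  have key : (tanhDerivPoly n).map (algebraMap ℝ ℂ) = C (Complex.I ^ ((n : ℤ) - 1)) *
      ((tanDerivPoly n).map (algebraMap ℝ ℂ)).comp (C Complex.I * X) := by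
    induction n with
    | zero =>
      have h1 : tanhDerivPoly 0 = X := (tanhDerivPoly_spec 0).unique fun θ => by simp
      have h2 : tanDerivPoly 0 = X := (tanDerivPoly_spec 0).unique fun θ _ => by simp
      rw [h1, h2]
      simp [← mul_assoc, ← C_mul]
    | succ n ih =>
      rw [(tanhDerivPoly_spec (n + 1)).unique (tanhDerivPoly_spec n).succ,
        (tanDerivPoly_spec (n + 1)).unique (tanDerivPoly_spec n).succ]
      have hd := congrArg derivative ih
      rw [derivative_map, derivative_C_mul, derivative_comp, derivative_map] at hd
      have hI : (C Complex.I : ℂ[X]) ^ 2 = -1 := by rw [← C_pow]; simp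
      have hz : (C (Complex.I ^ (((n + 1 : ℕ) : ℤ) - 1)) : ℂ[X]) =
          C (Complex.I ^ ((n : ℤ) - 1)) * C Complex.I := by
        rw [← C_mul, ← zpow_add_one₀ Complex.I_ne_zero]
        congr 2
        push_cast
        ring
      rw [hz]
      simp only [Polynomial.map_mul, Polynomial.map_sub, Polynomial.map_add, Polynomial.map_one,
        Polynomial.map_pow, Polynomial.map_X, hd, mul_comp, add_comp, one_comp, pow_comp, X_comp,
        derivative_C_mul, derivative_X, mul_pow, hI]
      ring
  rw [altTanPoly, Polynomial.map_mul, key, C_mul]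
  simp [mul_assoc]

/-- The second description of `q_n`, through the derivative polynomials for the secant. -/
theorem altSecPoly_eq_sec (n : ℕ) :
    (altSecPoly n).map (algebraMap ℝ ℂ) =
      C ((-1) ^ n * 2 ^ n * Complex.I ^ n) *
        ((secDerivPoly n).map (algebraMap ℝ ℂ)).comp (C Complex.I * X) := by
  have key : (sechDerivPoly n).map (algebraMap ℝ ℂ) = C Complex.I ^ n *
      ((secDerivPoly n).map (algebraMap ℝ ℂ)).comp (C Complex.I * X) := by
    induction n with
    | zero =>
      have h1 : sechDerivPoly 0 = 1 := (sechDerivPoly_spec 0).unique fun θ => by simp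
      have h2 : secDerivPoly 0 = 1 := (secDerivPoly_spec 0).unique fun θ _ => by simp
      rw [h1, h2]
      simp
    | succ n ih =>
      rw [(sechDerivPoly_spec (n + 1)).unique (sechDerivPoly_spec n).succ,
        (secDerivPoly_spec (n + 1)).unique (secDerivPoly_spec n).succ]
      have hd := congrArg derivative ih
      rw [derivative_map, ← C_pow, derivative_C_mul, derivative_comp, derivative_map] at hd
      have hI : (C Complex.I : ℂ[X]) ^ 2 = -1 := by rw [← C_pow]; simp
      simp only [Polynomial.map_mul, Polynomial.map_sub, Polynomial.map_add, Polynomial.map_one,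
        Polynomial.map_pow, Polynomial.map_X, hd, ih, mul_comp, add_comp, one_comp, pow_comp,
        X_comp, derivative_C_mul, derivative_X, mul_pow, hI, C_pow]
      rw [pow_succ]
      linear_combination (- C Complex.I ^ n *
        ((secDerivPoly n).map (algebraMap ℝ ℂ)).comp (C Complex.I * X) * X) * hI
  rw [altSecPoly, Polynomial.map_mul, key, C_mul]
  have h2 : (C 2 : ℂ[X]) = 2 := rfl
  simp [mul_assoc, h2]

/-! ### Peaks and double descents of permutations -/

/-- The value `π(i)` of a permutation `π` of `{1, …, n}` for `1 ≤ i ≤ n`, and `0` for every other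
index, so that `π(0) = π(n + 1) = 0`. A permutation of `{1, …, n}` is an `Equiv.Perm (Fin n)`,
where `j : Fin n` stands for `j + 1`. -/
def permVal {n : ℕ} (π : Equiv.Perm (Fin n)) (i : ℕ) : ℕ :=
  if h : 1 ≤ i ∧ i ≤ n then (π ⟨i - 1, by omega⟩ : ℕ) + 1 else 0

/-- `π(i-1) < π(i) > π(i+1)` (used for `i ≥ 1`). -/
def IsPeak {n : ℕ} (π : Equiv.Perm (Fin n)) (i : ℕ) : Prop :=
  permVal π (i - 1) < permVal π i ∧ permVal π (i + 1) < permVal π i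

/-- `π(i-1) > π(i) > π(i+1)` (used for `i ≥ 1`). -/
def IsDoubleDescent {n : ℕ} (π : Equiv.Perm (Fin n)) (i : ℕ) : Prop :=
  permVal π i < permVal π (i - 1) ∧ permVal π (i + 1) < permVal π i

instance decidableIsPeak {n : ℕ} (π : Equiv.Perm (Fin n)) (i : ℕ) :
    Decidable (IsPeak π i) :=
  inferInstanceAs (Decidable (permVal π (i - 1) < permVal π i ∧
    permVal π (i + 1) < permVal π i))

instance decidableIsDoubleDescent {n : ℕ} (π : Equiv.Perm (Fin n)) (i : ℕ) :
    Decidable (IsDoubleDescent π i) :=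
  inferInstanceAs (Decidable (permVal π i < permVal π (i - 1) ∧
    permVal π (i + 1) < permVal π i))

/-- The number of peaks `i ∈ {1, …, n}`, with `π(0) = π(n + 1) = 0`. -/
def numPeaks {n : ℕ} (π : Equiv.Perm (Fin n)) : ℕ :=
  ((Finset.Icc 1 n).filter (IsPeak π)).card

/-- The number of double descents `i ∈ {1, …, n}`, with `π(0) = π(n + 1) = 0`. -/
def numDoubleDescents {n : ℕ} (π : Equiv.Perm (Fin n)) : ℕ :=
  ((Finset.Icc 1 n).filter (IsDoubleDescent π)).card

/-- The number of left peaks: peaks `i ∈ {1, …, n - 1}`, with `π(0) = 0`. -/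
def numLeftPeaks {n : ℕ} (π : Equiv.Perm (Fin n)) : ℕ :=
  ((Finset.Ico 1 n).filter (IsPeak π)).card

/-- `a(n,k)`: the number of permutations of `{1, …, n}` with `k` peaks and without double
descents. -/
def peakCount (n k : ℕ) : ℕ :=
  (Finset.univ.filter fun π : Equiv.Perm (Fin n) =>
    numPeaks π = k ∧ numDoubleDescents π = 0).card

/-- `b(n,k)`: the number of permutations of `{1, …, n}` with `k` left peaks. -/
def leftPeakCount (n k : ℕ) : ℕ :=
  (Finset.univ.filter fun π : Equiv.Perm (Fin n) => numLeftPeaks π = k).card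

/-!
Read a permutation `π` of `{1, …, n}` as the word `0, π(1), …, π(n), e`, with `e = 0` for the tangent
and `e = ∞` for the secant; in the second case the peaks of the word are exactly the left peaks
of `π`. Give every letter the weight `U`, `S`, `R` or `1` according to whether it is a peak, a double
ascent, a double descent or a valley, and multiply.

Inserting `n + 1` into one of the `n + 1` gaps makes it a peak and changes the type of one old letter
only: in an ascent, the letter after the gap; in a descent, the letter before it. Hence a
peak contributes `U (S + R)` over all gaps and a double ascent or double descent contributes `U`. This
is the action of a derivation with `U ↦ U (S + R)`, `S ↦ U`, `R ↦ U`, so the sum over all insertions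
is that derivation applied to the weight (`sum_wordWeight_insertLetter`). If `e = ∞`, the last gap
is an ascent to an outer letter, and contributes an additional factor `S`.

* For the tangent, `p_{n+1} = (x² - 1) p_n'`, and the derivation `(x² - 1) d/dx` has the required form
  for `U = x² - 1`, `S = x + a`, `R = x - a` with any constant `a`. So `p_n` is the total weight for
  every `a` (`altTanPoly_eq_sum_wordWeight`). Evaluating at `x = a` turns `R` into `0`, leaving only
  the permutations without double descents, with `S = 2x`.
* For the secant, `q_{n+1} = 2 (x² - 1) q_n' + 2x q_n`, and the derivation `2 (x² - 1) d/dx` has the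
  required form for `U = 4 (x² - 1)`, `S = R = 2x` (`altSecPoly_eq_sum_wordWeight`).

The exponents of `2x` come from the alternation of peaks and valleys (`two_mul_wordPeaks_add`).
-/

open Finset in
theorem prod_range_erase_eq {A : Type*} [CommMonoid A] (W : ℕ → A) (j m : ℕ) :
    ∏ i ∈ (range (j + 1 + m)).erase j, W i =
      (∏ i ∈ range j, W i) * ∏ i ∈ range m, W (j + 1 + i) := by
  have h : ∏ i ∈ (range (j + 1 + m)).erase j, W i =
      ∏ i ∈ (range (j + 1 + m)).erase j, if i = j then 1 else W i :=
    prod_congr rfl fun i hi => by rw [if_neg (ne_of_mem_erase hi)]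
  rw [h, prod_erase _ (f := fun i => if i = j then 1 else W i) (if_pos rfl), prod_range_add, prod_range_succ, if_pos rfl, mul_one]
  congr 1
  · exact prod_congr rfl fun i hi => if_neg (mem_range.1 hi).ne
  · exact prod_congr rfl fun i _ => if_neg (by omega)

/-! ### Weights of words and insertion of a letter -/

/-- The weight of a letter `y` between its neighbours `x` and `z`: `U` for a peak, `S` for a double
ascent, `R` for a double descent, and `1` for a valley. -/
def letterWeight {α A : Type*} [LinearOrder α] [One A] (U S R : A) (x y z : α) : A :=
  if x < y then if z < y then U else S else if z < y then R else 1

/-- The product of the weights of the letters `f 1, …, f n` of the word `f 0, f 1, …, f (n + 1)`;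
the two outer letters serve as neighbours only. -/
def wordWeight {α A : Type*} [LinearOrder α] [CommMonoid A] (U S R : A) (f : ℕ → α) (n : ℕ) : A :=
  ∏ i ∈ Finset.range n, letterWeight U S R (f i) (f (i + 1)) (f (i + 2))

/-- The word `f` with the letter `N` inserted between `f j` and `f (j + 1)`. -/
def insertLetter {α : Type*} (f : ℕ → α) (j : ℕ) (N : α) (i : ℕ) : α :=
  if i ≤ j then f i else if i = j + 1 then N else f (i - 1)

section Insert

variable {α A : Type*} (f : ℕ → α) {j : ℕ} {N : α}

theorem insertLetter_of_le {i : ℕ} (h : i ≤ j) : insertLetter f j N i = f i := if_pos h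

theorem insertLetter_self : insertLetter f j N (j + 1) = N := by
  simp [insertLetter]

theorem insertLetter_succ_of_lt {i : ℕ} (h : j < i) : insertLetter f j N (i + 1) = f i := by
  rw [insertLetter, if_neg (by omega), if_neg (by omega), Nat.add_sub_cancel]

variable [LinearOrder α] [CommMonoid A] (U S R : A)

open Finset in
/-- The letters before an ascent keep their weights when a large letter is put into it. -/
theorem prod_letterWeight_insertLetter_of_asc (hlt : f j < f (j + 1)) (hN : f j < N) :
    ∏ i ∈ range j, letterWeight U S R (insertLetter f j N i) (insertLetter f j N (i + 1))
        (insertLetter f j N (i + 2)) =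
      ∏ i ∈ range j, letterWeight U S R (f i) (f (i + 1)) (f (i + 2)) := by
  refine prod_congr rfl fun i hi => ?_
  have hi := mem_range.1 hi
  rw [insertLetter_of_le f hi.le, insertLetter_of_le f (i := i + 1) hi]
  rcases Nat.lt_or_ge (i + 1) j with h | h
  · rw [insertLetter_of_le f (i := i + 2) h]
  · obtain rfl : j = i + 1 := by omega
    rw [insertLetter_self]
    simp only [letterWeight, hN.not_gt, hlt.not_gt, if_false]

/-- Inserting a maximal letter into the ascent before the letter `f (j + 1)` creates a peak and
changes, among the old letters, the weight of `f (j + 1)` only: a peak becomes a double descent, a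
double ascent a valley. -/
theorem wordWeight_insertLetter_of_asc (m : ℕ) (hlt : f j < f (j + 1)) (hN : f (j + 1) < N) :
    wordWeight U S R (insertLetter f j N) (j + 1 + m + 1) =
      (∏ i ∈ (Finset.range (j + 1 + m)).erase j,
        letterWeight U S R (f i) (f (i + 1)) (f (i + 2))) *
        if f (j + 2) < f (j + 1) then U * R else U := by
  rw [prod_range_erase_eq, wordWeight, show j + 1 + m + 1 = j + (m + 1 + 1) by ring,
    Finset.prod_range_add, Finset.prod_range_succ', Finset.prod_range_succ',
    prod_letterWeight_insertLetter_of_asc f U S R hlt (hlt.trans hN), mul_assoc, mul_assoc]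
  congr 1
  congr 1
  · refine Finset.prod_congr rfl fun i _ => ?_
    rw [show j + (i + 1 + 1) = j + 1 + i + 1 by ring,
      insertLetter_succ_of_lt f (by omega), insertLetter_succ_of_lt f (by omega),
      insertLetter_succ_of_lt f (by omega)]
  · rw [show j + (0 + 1) = j + 1 by ring, add_zero, insertLetter_of_le f le_rfl,
      insertLetter_self, insertLetter_succ_of_lt f (i := j + 1) (by omega),
      insertLetter_succ_of_lt f (i := j + 2) (by omega)]
    simp only [letterWeight, hN, hN.not_gt, hlt.trans hN, if_true, if_false]
    split_ifs
    · exact mul_comm _ _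
    · exact one_mul _

/-- Inserting a maximal letter into the descent after the letter `f (j + 1)` creates a peak and
changes, among the old letters, the weight of `f (j + 1)` only: a peak becomes a double ascent, a
double descent a valley. -/
theorem wordWeight_insertLetter_of_desc (m : ℕ) (hlt : f (j + 2) < f (j + 1))
    (hN : f (j + 1) < N) :
    wordWeight U S R (insertLetter f (j + 1) N) (j + 1 + m + 1) =
      (∏ i ∈ (Finset.range (j + 1 + m)).erase j,
        letterWeight U S R (f i) (f (i + 1)) (f (i + 2))) *
        if f j < f (j + 1) then U * S else U := by
  rw [prod_range_erase_eq, wordWeight, show j + 1 + m + 1 = j + (m + 1 + 1) by ring,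
    Finset.prod_range_add, Finset.prod_range_succ', Finset.prod_range_succ', mul_assoc, mul_assoc]
  congr 1
  · refine Finset.prod_congr rfl fun i hi => ?_
    have hi := Finset.mem_range.1 hi
    rw [insertLetter_of_le f (by omega), insertLetter_of_le f (by omega),
      insertLetter_of_le f (by omega)]
  congr 1
  · refine Finset.prod_congr rfl fun i _ => ?_
    rw [show j + (i + 1 + 1) = j + 1 + i + 1 by ring]
    rw [insertLetter_succ_of_lt f (i := j + 1 + i + 1) (by omega),
      insertLetter_succ_of_lt f (i := j + 1 + i + 2) (by omega)]
    rcases Nat.eq_zero_or_pos i with rfl | hi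
    · rw [add_zero, insertLetter_self]
      have hlt' : f (j + 1 + 1) < f (j + 1) := hlt
      simp only [letterWeight, (hlt'.trans hN).not_gt, hlt'.not_gt, if_false]
    · rw [insertLetter_succ_of_lt f (i := j + 1 + i) (by omega)]
  · have h1 : insertLetter f (j + 1) N (j + 2) = N := insertLetter_self f
    have h2 : insertLetter f (j + 1) N (j + 3) = f (j + 2) :=
      insertLetter_succ_of_lt f (Nat.lt_succ_self _)
    change letterWeight U S R (insertLetter f (j + 1) N (j + 1)) (insertLetter f (j + 1) N (j + 2))
        (insertLetter f (j + 1) N (j + 3)) *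
      letterWeight U S R (insertLetter f (j + 1) N j) (insertLetter f (j + 1) N (j + 1))
        (insertLetter f (j + 1) N (j + 2)) = _
    rw [h1, h2, insertLetter_of_le f le_rfl, insertLetter_of_le f (Nat.le_succ j)]
    simp only [letterWeight, hN, hN.not_gt, hlt.trans hN, if_true, if_false]
    split_ifs
    · rfl
    · exact mul_one _

/-- Inserting a letter into a final ascent creates a double ascent and changes no other weight. -/
theorem wordWeight_insertLetter_last (n : ℕ) (hlt : f n < f (n + 1)) (hN : f n < N)
    (hN' : N ≤ f (n + 1)) :
    wordWeight U S R (insertLetter f n N) (n + 1) = S * wordWeight U S R f n := by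
  rw [wordWeight, Finset.prod_range_succ,
    prod_letterWeight_insertLetter_of_asc f U S R hlt hN, insertLetter_of_le f le_rfl,
    insertLetter_self, insertLetter_succ_of_lt f (i := n + 1) (by omega), mul_comm]
  simp only [letterWeight, hN, hN'.not_gt, if_true, if_false, wordWeight]

end Insert

/-- Inserting a maximal letter in all possible ways acts on weights as a differential operator. -/
theorem sum_wordWeight_insertLetter {α : Type*} [LinearOrder α] {c U S R : ℝ[X]}
    (hU : c * derivative U = U * (S + R)) (hS : c * derivative S = U)
    (hR : c * derivative R = U) {f : ℕ → α} {n : ℕ} {N : α} (h0 : f 0 < f 1)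
    (hne : ∀ j ≤ n, f j ≠ f (j + 1)) (hN : ∀ j ≤ n, f j < N)
    (hlast : f n < f (n + 1) → N ≤ f (n + 1)) :
    ∑ j ∈ Finset.range (n + 1), wordWeight U S R (insertLetter f j N) (n + 1) =
      c * derivative (wordWeight U S R f n) +
        if f n < f (n + 1) then S * wordWeight U S R f n else 0 := by
  have hsplit : ∀ j ∈ Finset.range (n + 1),
      wordWeight U S R (insertLetter f j N) (n + 1) =
        (if f j < f (j + 1) then wordWeight U S R (insertLetter f j N) (n + 1) else 0) +
        if f (j + 1) < f j then wordWeight U S R (insertLetter f j N) (n + 1) else 0 := by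
    intro j hj
    have hj := Finset.mem_range.1 hj
    rcases lt_or_gt_of_ne (hne j (by omega)) with h | h
    · rw [if_pos h, if_neg h.not_gt, add_zero]
    · rw [if_pos h, if_neg h.not_gt, zero_add]
  have hend : (if f n < f (n + 1) then wordWeight U S R (insertLetter f n N) (n + 1) else 0) =
      if f n < f (n + 1) then S * wordWeight U S R f n else 0 := by
    split_ifs with h
    · exact wordWeight_insertLetter_last f U S R n h (hN n le_rfl) (hlast h)
    · rfl
  -- Ascents are indexed by the letter after them, descents by the letter before them.
  rw [Finset.sum_congr rfl hsplit, Finset.sum_add_distrib, Finset.sum_range_succ, hend,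
    Finset.sum_range_succ' _ n, if_neg h0.not_gt, add_zero, add_right_comm,
    ← Finset.sum_add_distrib]
  congr 1
  rw [wordWeight, derivative_prod_finset, Finset.mul_sum]
  refine Finset.sum_congr rfl fun j hj => ?_
  obtain ⟨m, rfl⟩ := Nat.exists_eq_add_of_le (Nat.succ_le_of_lt (Finset.mem_range.1 hj))
  have hjN := hN (j + 1) (by omega)
  have hasc := fun h => wordWeight_insertLetter_of_asc f U S R (N := N) (j := j) m h hjN
  have hdesc := fun h => wordWeight_insertLetter_of_desc f U S R (N := N) (j := j) m h hjN
  rw [mul_left_comm]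
  generalize ∏ i ∈ (Finset.range (j + 1 + m)).erase j,
    letterWeight U S R (f i) (f (i + 1)) (f (i + 2)) = P at *
  by_cases h1 : f j < f (j + 1) <;> by_cases h2 : f (j + 1 + 1) < f (j + 1)
  · rw [if_pos h1, if_pos h2, hasc h1, hdesc h2, if_pos h1, if_pos h2, letterWeight, if_pos h1,
      if_pos h2, hU]
    ring
  · rw [if_pos h1, if_neg h2, hasc h1, if_neg h2, letterWeight, if_pos h1, if_neg h2, hS, add_zero]
  · rw [if_neg h1, if_pos h2, hdesc h2, if_neg h1, letterWeight, if_neg h1, if_pos h2, hR, zero_add]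
  · rw [if_neg h1, if_neg h2, letterWeight, if_neg h1, if_neg h2]
    simp

/-! ### Weights and statistics of words -/

section Statistics

variable {α : Type*} [LinearOrder α] (f : ℕ → α) (n : ℕ)

/-- The number of peaks among the letters `f 1, …, f n` of the word `f 0, …, f (n + 1)`. -/
def wordPeaks : ℕ :=
  ((Finset.range n).filter fun i => f i < f (i + 1) ∧ f (i + 2) < f (i + 1)).card

/-- The number of letters among `f 1, …, f n` that exceed the letter before them and do not exceed
the letter after them. -/
def wordDoubleAscents : ℕ :=
  ((Finset.range n).filter fun i => f i < f (i + 1) ∧ ¬ f (i + 2) < f (i + 1)).card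

/-- The number of letters among `f 1, …, f n` that do not exceed the letter before them and exceed
the letter after them. -/
def wordDoubleDescents : ℕ :=
  ((Finset.range n).filter fun i => ¬ f i < f (i + 1) ∧ f (i + 2) < f (i + 1)).card

theorem wordWeight_eq {A : Type*} [CommMonoid A] (U S R : A) :
    wordWeight U S R f n =
      U ^ wordPeaks f n * S ^ wordDoubleAscents f n * R ^ wordDoubleDescents f n := by
  simp only [wordPeaks, wordDoubleAscents, wordDoubleDescents, Finset.card_filter,
    ← Finset.prod_pow_eq_pow_sum, ← Finset.prod_mul_distrib, wordWeight]
  refine Finset.prod_congr rfl fun i _ => ?_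
  by_cases h1 : f i < f (i + 1) <;> by_cases h2 : f (i + 2) < f (i + 1) <;>
    simp [letterWeight, h1, h2]

theorem sum_ascent_sub_ascent :
    ∑ i ∈ Finset.range n,
        ((if f i < f (i + 1) then 1 else 0) - if f (i + 1) < f (i + 2) then 1 else 0 : ℤ) =
      (if f 0 < f 1 then 1 else 0) - if f n < f (n + 1) then 1 else 0 :=
  Finset.sum_range_sub' (fun i => (if f i < f (i + 1) then 1 else 0 : ℤ)) n

variable {f n}

/-- Peaks and valleys alternate, so the letters of each kind are counted by the number of peaks,
up to a correction at the two ends. -/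
theorem two_mul_wordPeaks_add (hne : ∀ j ≤ n, f j ≠ f (j + 1)) :
    (2 * wordPeaks f n + wordDoubleAscents f n + wordDoubleDescents f n : ℤ) =
      n + ((if f 0 < f 1 then 1 else 0) - if f n < f (n + 1) then 1 else 0) := by
  rw [← sum_ascent_sub_ascent]
  have hn : (n : ℤ) = ∑ i ∈ Finset.range n, 1 := by simp
  simp only [wordPeaks, wordDoubleAscents, wordDoubleDescents, Finset.card_filter, Nat.cast_sum]
  rw [hn, Finset.mul_sum, ← Finset.sum_add_distrib, ← Finset.sum_add_distrib,
    ← Finset.sum_add_distrib]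
  refine Finset.sum_congr rfl fun i hi => ?_
  have h3 : f (i + 1) < f (i + 2) ↔ ¬ f (i + 2) < f (i + 1) := by
    have := hne (i + 1) (Finset.mem_range.1 hi)
    rw [not_lt, le_iff_lt_or_eq, or_iff_left this]
  by_cases h1 : f i < f (i + 1) <;> by_cases h2 : f (i + 2) < f (i + 1) <;> simp [h1, h2, h3]

theorem le_wordPeaks (hne : ∀ j ≤ n, f j ≠ f (j + 1)) :
    (if f 0 < f 1 then 1 else 0) - (if f n < f (n + 1) then 1 else 0) ≤ (wordPeaks f n : ℤ) := by
  rw [← sum_ascent_sub_ascent, wordPeaks, Finset.card_filter, Nat.cast_sum]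
  refine Finset.sum_le_sum fun i hi => ?_
  have h3 : f (i + 1) < f (i + 2) ↔ ¬ f (i + 2) < f (i + 1) := by
    have := hne (i + 1) (Finset.mem_range.1 hi)
    rw [not_lt, le_iff_lt_or_eq, or_iff_left this]
  by_cases h1 : f i < f (i + 1) <;> by_cases h2 : f (i + 2) < f (i + 1) <;> simp [h1, h2, h3]

end Statistics

/-! ### Permutations as words -/

/-- The permutation of `{1, …, n + 1}` obtained from `π` by inserting the letter `n + 1` after the
first `j` letters. -/
def insertMax {n : ℕ} (j : Fin (n + 1)) (π : Equiv.Perm (Fin n)) : Equiv.Perm (Fin (n + 1)) :=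
  (finSuccEquiv' j).trans (π.optionCongr.trans finSuccEquivLast.symm)

theorem insertMax_self {n : ℕ} (j : Fin (n + 1)) (π : Equiv.Perm (Fin n)) :
    insertMax j π j = Fin.last n := by
  simp [insertMax]

theorem insertMax_succAbove {n : ℕ} (j : Fin (n + 1)) (π : Equiv.Perm (Fin n)) (i : Fin n) :
    insertMax j π (j.succAbove i) = (π i).castSucc := by
  simp [insertMax]

theorem insertMax_bijective (n : ℕ) :
    Function.Bijective fun p : Equiv.Perm (Fin n) × Fin (n + 1) => insertMax p.2 p.1 := by
  rw [Fintype.bijective_iff_injective_and_card]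
  refine ⟨?_, by simp [Fintype.card_perm, Nat.factorial_succ, mul_comm]⟩
  rintro ⟨π, j⟩ ⟨ρ, k⟩ h
  have h : insertMax j π = insertMax k ρ := h
  obtain rfl : j = k := by
    apply (insertMax k ρ).injective
    rw [insertMax_self, ← h, insertMax_self]
  have hπ : π = ρ := Equiv.ext fun i => by
    have := insertMax_succAbove j π i
    rw [h, insertMax_succAbove] at this
    exact (Fin.castSucc_injective n this).symm
  rw [hπ]

theorem permVal_of_lt {n : ℕ} (π : Equiv.Perm (Fin n)) {i : ℕ} (h : i < n) :
    permVal π (i + 1) = (π ⟨i, h⟩ : ℕ) + 1 := by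
  rw [permVal, dif_pos ⟨by omega, h⟩]
  rfl

theorem permVal_zero {n : ℕ} (π : Equiv.Perm (Fin n)) : permVal π 0 = 0 := by
  simp [permVal]

theorem permVal_of_gt {n : ℕ} (π : Equiv.Perm (Fin n)) {i : ℕ} (h : n < i) :
    permVal π i = 0 := by
  rw [permVal, dif_neg (by omega)]

theorem permVal_le {n : ℕ} (π : Equiv.Perm (Fin n)) (i : ℕ) : permVal π i ≤ n := by
  rw [permVal]
  split_ifs
  · exact (π _).isLt
  · exact Nat.zero_le n

/-- The word `0, π(1), …, π(n), e`; the end letter `e` is allowed to be infinite. -/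
def permWord {n : ℕ} (e : WithTop ℕ) (π : Equiv.Perm (Fin n)) (i : ℕ) : WithTop ℕ :=
  if i ≤ n then permVal π i else e

section PermWord

variable {n : ℕ} (e : WithTop ℕ) (π : Equiv.Perm (Fin n))

theorem permWord_of_le {i : ℕ} (h : i ≤ n) : permWord e π i = permVal π i := if_pos h

theorem permWord_of_gt {i : ℕ} (h : n < i) : permWord e π i = e := if_neg h.not_ge

theorem permWord_insertMax (j : Fin (n + 1)) :
    permWord e (insertMax j π) = insertLetter (permWord e π) j ((n + 1 : ℕ) : WithTop ℕ) := by
  funext i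
  rcases Nat.lt_or_ge (n + 1) i with hi | hi
  · rw [permWord_of_gt e _ hi, insertLetter, if_neg (by omega), if_neg (by omega),
      permWord_of_gt e _ (by omega)]
  rw [permWord_of_le e _ hi]
  rcases i with _ | i
  · rw [insertLetter_of_le _ (Nat.zero_le _), permWord_of_le e _ (Nat.zero_le _), permVal_zero,
      permVal_zero]
  rw [permVal_of_lt _ hi]
  rcases lt_trichotomy i j with h | h | h
  · have hn : i < n := by omega
    rw [insertLetter_of_le _ h, permWord_of_le e _ hn, permVal_of_lt _ hn]
    have := insertMax_succAbove j π ⟨i, hn⟩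
    rw [Fin.succAbove_of_castSucc_lt _ _ h] at this
    exact congrArg (fun x : Fin (n + 1) => ((x + 1 : ℕ) : WithTop ℕ)) this
  · subst h
    rw [insertLetter_self]
    exact congrArg (fun x : Fin (n + 1) => ((x + 1 : ℕ) : WithTop ℕ)) (insertMax_self j π)
  · obtain ⟨i, rfl⟩ : ∃ k, i = k + 1 := ⟨i - 1, by omega⟩
    have hn : i < n := by omega
    rw [insertLetter_succ_of_lt _ h, permWord_of_le e _ hn, permVal_of_lt _ hn]
    have := insertMax_succAbove j π ⟨i, hn⟩
    rw [Fin.succAbove_of_le_castSucc _ _ (Nat.le_of_lt_succ h)] at this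
    exact congrArg (fun x : Fin (n + 1) => ((x + 1 : ℕ) : WithTop ℕ)) this

theorem permWord_lt {i : ℕ} (h : i ≤ n) : permWord e π i < ((n + 1 : ℕ) : WithTop ℕ) := by
  rw [permWord_of_le e π h]
  exact_mod_cast Nat.lt_succ_of_le (permVal_le π i)

theorem permWord_zero_lt_one (h : 1 ≤ n ∨ 0 < e) : permWord e π 0 < permWord e π 1 := by
  rw [permWord_of_le e π (Nat.zero_le n), permVal_zero]
  rcases Nat.eq_zero_or_pos n with rfl | hn
  · rw [permWord_of_gt e π one_pos]
    simpa using h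
  · rw [permWord_of_le e π hn, permVal_of_lt π hn]
    exact_mod_cast Nat.succ_pos _

theorem permWord_ne_succ (h : 1 ≤ n ∧ e = 0 ∨ e = ⊤) {j : ℕ} (hj : j ≤ n) :
    permWord e π j ≠ permWord e π (j + 1) := by
  rw [permWord_of_le e π hj]
  rcases hj.eq_or_lt with rfl | hj
  · rw [permWord_of_gt e π (Nat.lt_succ_self _)]
    rcases h with ⟨hn, rfl⟩ | rfl
    · obtain ⟨m, rfl⟩ := Nat.exists_eq_add_of_le' hn
      rw [permVal_of_lt π (Nat.lt_succ_self m)]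
      exact_mod_cast Nat.succ_ne_zero (π ⟨m, Nat.lt_succ_self m⟩ : ℕ)
    · exact WithTop.coe_ne_top
  · rw [permWord_of_le e π hj, permVal_of_lt π hj]
    rcases j with _ | j
    · rw [permVal_zero]
      exact_mod_cast (Nat.succ_ne_zero (π ⟨0, hj⟩ : ℕ)).symm
    · rw [permVal_of_lt π (by omega)]
      intro h
      have h : (π ⟨j, by omega⟩ : ℕ) + 1 = (π ⟨j + 1, hj⟩ : ℕ) + 1 := by exact_mod_cast h
      have := π.injective (Fin.ext (Nat.succ_injective h))
      simp at this

end PermWord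

/-- Every permutation of `{1, …, n + 1}` arises exactly once by inserting `n + 1` into a permutation
of `{1, …, n}`, so the total weight obeys the differential recurrence of a single word. -/
theorem sum_wordWeight_succ {c U S R : ℝ[X]} (hU : c * derivative U = U * (S + R))
    (hS : c * derivative S = U) (hR : c * derivative R = U) (n : ℕ) {e : WithTop ℕ}
    (he : 1 ≤ n ∧ e = 0 ∨ e = ⊤) :
    ∑ σ : Equiv.Perm (Fin (n + 1)), wordWeight U S R (permWord e σ) (n + 1) =
      c * derivative (∑ π : Equiv.Perm (Fin n), wordWeight U S R (permWord e π) n) +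
        if e = ⊤ then S * ∑ π : Equiv.Perm (Fin n), wordWeight U S R (permWord e π) n else 0 := by
  have hsplit : (if e = ⊤ then
      S * ∑ π : Equiv.Perm (Fin n), wordWeight U S R (permWord e π) n else 0) =
      ∑ π : Equiv.Perm (Fin n), if e = ⊤ then S * wordWeight U S R (permWord e π) n else 0 := by
    split_ifs
    · exact Finset.mul_sum _ _ _
    · exact Finset.sum_const_zero.symm
  rw [← (insertMax_bijective n).sum_comp fun σ => wordWeight U S R (permWord e σ) (n + 1),
    Fintype.sum_prod_type, derivative_sum, Finset.mul_sum, hsplit, ← Finset.sum_add_distrib]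
  refine Finset.sum_congr rfl fun π _ => ?_
  have hend : permWord e π n < permWord e π (n + 1) ↔ e = ⊤ := by
    rw [permWord_of_gt e π (Nat.lt_succ_self n)]
    rcases he with ⟨-, rfl⟩ | rfl
    · simp
    · simp [permWord]
  have h := sum_wordWeight_insertLetter hU hS hR (f := permWord e π) (n := n)
    (N := ((n + 1 : ℕ) : WithTop ℕ))
    (permWord_zero_lt_one e π (he.imp And.left fun h : e = ⊤ => h ▸ WithTop.top_pos))
    (fun j hj => permWord_ne_succ e π he hj) (fun j hj => permWord_lt e π hj)
    (fun h => by
      rw [permWord_of_gt e π (Nat.lt_succ_self n), hend.1 h]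
      exact le_top)
  simp only [hend] at h
  rw [← h, Finset.sum_range]
  simp only [permWord_insertMax]

theorem card_filter_range_eq_card_filter_Icc (p : ℕ → Prop) [DecidablePred p] (n : ℕ) :
    ((Finset.range n).filter fun i => p (i + 1)).card = ((Finset.Icc 1 n).filter p).card := by
  rw [Finset.card_filter, Finset.card_filter, ← Finset.Ico_add_one_right_eq_Icc,
    Finset.sum_Ico_eq_sum_range]
  simp only [add_tsub_cancel_right, add_comm 1]

theorem permWord_zero_eq {n : ℕ} (π : Equiv.Perm (Fin n)) (i : ℕ) :
    permWord 0 π i = permVal π i := by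
  rcases Nat.lt_or_ge n i with h | h
  · rw [permWord_of_gt 0 π h, permVal_of_gt π h, Nat.cast_zero]
  · exact permWord_of_le 0 π h

theorem wordPeaks_permWord_zero {n : ℕ} (π : Equiv.Perm (Fin n)) :
    wordPeaks (permWord 0 π) n = numPeaks π := by
  rw [wordPeaks, numPeaks, ← card_filter_range_eq_card_filter_Icc]
  simp only [permWord_zero_eq, IsPeak, Nat.cast_lt, Nat.add_sub_cancel]

theorem wordDoubleDescents_permWord_zero {n : ℕ} (hn : 1 ≤ n) (π : Equiv.Perm (Fin n)) :
    wordDoubleDescents (permWord 0 π) n = numDoubleDescents π := by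
  rw [wordDoubleDescents, numDoubleDescents, ← card_filter_range_eq_card_filter_Icc]
  refine congrArg _ (Finset.filter_congr fun i hi => and_congr ?_ ?_)
  · have := permWord_ne_succ 0 π (Or.inl ⟨hn, rfl⟩) (Finset.mem_range.1 hi).le
    rw [not_lt, le_iff_lt_or_eq, or_iff_left this.symm, permWord_zero_eq, permWord_zero_eq,
      Nat.cast_lt, Nat.add_sub_cancel]
  · rw [permWord_zero_eq, permWord_zero_eq, Nat.cast_lt]

theorem wordPeaks_permWord_top {n : ℕ} (π : Equiv.Perm (Fin n)) :
    wordPeaks (permWord ⊤ π) n = numLeftPeaks π := by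
  have hIco : (Finset.Ico 1 n).filter (IsPeak π) =
      (Finset.Icc 1 n).filter fun i => i < n ∧ IsPeak π i := by
    ext i
    simp only [Finset.mem_filter, Finset.mem_Ico, Finset.mem_Icc]
    exact ⟨fun h => ⟨⟨h.1.1, h.1.2.le⟩, h.1.2, h.2⟩, fun h => ⟨⟨h.1.1, h.2.1⟩, h.2.2⟩⟩
  rw [wordPeaks, numLeftPeaks, hIco, ← card_filter_range_eq_card_filter_Icc]
  refine congrArg _ (Finset.filter_congr fun i hi => ?_)
  have hi := Finset.mem_range.1 hi
  rw [permWord_of_le ⊤ π hi.le, permWord_of_le ⊤ π hi, Nat.cast_lt]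
  rcases Nat.lt_or_ge (i + 1) n with h | h
  · rw [permWord_of_le ⊤ π h, Nat.cast_lt, and_iff_right h]
    rfl
  · rw [permWord_of_gt ⊤ π (Nat.lt_succ_of_le h)]
    simp [h.not_gt]

/-! ### Differential recurrences -/

theorem altTanPoly_succ (n : ℕ) :
    altTanPoly (n + 1) = (X ^ 2 - 1) * derivative (altTanPoly n) := by
  rw [altTanPoly, altTanPoly, (tanhDerivPoly_spec (n + 1)).unique (tanhDerivPoly_spec n).succ]
  have h : (-1 : ℝ[X]) ^ n = C ((-1) ^ n) := by simp
  rw [pow_succ, h, derivative_C_mul]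
  ring

theorem altSecPoly_succ (n : ℕ) :
    altSecPoly (n + 1) =
      2 * (X ^ 2 - 1) * derivative (altSecPoly n) + 2 * X * altSecPoly n := by
  rw [altSecPoly, altSecPoly, (sechDerivPoly_spec (n + 1)).unique (sechDerivPoly_spec n).succ]
  have h : (-1 : ℝ[X]) ^ n * 2 ^ n = C ((-1) ^ n * 2 ^ n) := by
    simp only [map_mul, map_pow, map_neg, map_one, map_ofNat]
  rw [pow_succ, pow_succ, h, derivative_C_mul, ← h]
  ring

theorem altTanPoly_one : altTanPoly 1 = X ^ 2 - 1 := by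
  have h0 : altTanPoly 0 = X := by
    rw [altTanPoly, (tanhDerivPoly_spec 0).unique (P' := X) fun θ => by simp]
    simp
  rw [altTanPoly_succ, h0, derivative_X, mul_one]

theorem altSecPoly_zero : altSecPoly 0 = 1 := by
  rw [altSecPoly, (sechDerivPoly_spec 0).unique (Q' := 1) fun θ => by simp]
  simp

/-- The parameter `a` is free: both `X + C a` and `X - C a` have derivative `1`, and only their sum
enters the derivative of the peak weight `X ^ 2 - 1`. -/
theorem altTanPoly_eq_sum_wordWeight (a : ℝ) (n : ℕ) :
    altTanPoly (n + 1) = ∑ π : Equiv.Perm (Fin (n + 1)),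
      wordWeight (X ^ 2 - 1) (X + C a) (X - C a) (permWord 0 π) (n + 1) := by
  induction n with
  | zero =>
    rw [altTanPoly_one, Fintype.sum_subsingleton _ (1 : Equiv.Perm (Fin 1))]
    simp [wordWeight, letterWeight, permWord, permVal]
  | succ n ih =>
    rw [altTanPoly_succ, ih, sum_wordWeight_succ (c := X ^ 2 - 1) _ _ _ (n + 1)
      (Or.inl ⟨Nat.le_add_left 1 n, rfl⟩), if_neg WithTop.zero_ne_top, add_zero]
    · simp only [derivative_sub, derivative_X_pow, derivative_one, map_natCast]
      push_cast
      ring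
    · simp
    · simp

theorem altSecPoly_eq_sum_wordWeight (n : ℕ) :
    altSecPoly n = ∑ π : Equiv.Perm (Fin n),
      wordWeight (4 * (X ^ 2 - 1)) (2 * X) (2 * X) (permWord ⊤ π) n := by
  induction n with
  | zero => simp [altSecPoly_zero, wordWeight]
  | succ n ih =>
    have h2 : 2 * (X ^ 2 - 1) * derivative (2 * X : ℝ[X]) = 4 * (X ^ 2 - 1) := by
      simp only [derivative_mul, derivative_ofNat, derivative_X]
      ring
    rw [altSecPoly_succ, ih, sum_wordWeight_succ (c := 2 * (X ^ 2 - 1)) _ h2 h2 n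
      (Or.inr rfl), if_pos rfl]
    simp only [derivative_mul, derivative_sub, derivative_X_pow, derivative_one, derivative_ofNat,
      map_natCast]
    push_cast
    ring

/-! ### Counting permutations by peaks -/

theorem eval_wordWeight {α : Type*} [LinearOrder α] (U S R : ℝ[X]) (f : ℕ → α) (n : ℕ) (a : ℝ) :
    (wordWeight U S R f n).eval a = wordWeight (U.eval a) (S.eval a) (R.eval a) f n := by
  simp only [wordWeight_eq, eval_mul, eval_pow]

theorem two_mul_numPeaks_add {n : ℕ} (hn : 1 ≤ n) (π : Equiv.Perm (Fin n)) :
    2 * numPeaks π + wordDoubleAscents (permWord 0 π) n + numDoubleDescents π = n + 1 := by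
  have h := two_mul_wordPeaks_add (f := permWord 0 π) (n := n)
    fun j hj => permWord_ne_succ 0 π (Or.inl ⟨hn, rfl⟩) hj
  rw [if_pos (permWord_zero_lt_one 0 π (Or.inl hn)), permWord_of_gt 0 π (Nat.lt_succ_self n),
    if_neg not_lt_zero, wordPeaks_permWord_zero, wordDoubleDescents_permWord_zero hn] at h
  omega

theorem one_le_numPeaks {n : ℕ} (hn : 1 ≤ n) (π : Equiv.Perm (Fin n)) : 1 ≤ numPeaks π := by
  have h := le_wordPeaks (f := permWord 0 π) (n := n)
    fun j hj => permWord_ne_succ 0 π (Or.inl ⟨hn, rfl⟩) hj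
  rw [if_pos (permWord_zero_lt_one 0 π (Or.inl hn)), permWord_of_gt 0 π (Nat.lt_succ_self n),
    if_neg not_lt_zero, wordPeaks_permWord_zero] at h
  omega

theorem two_mul_numLeftPeaks_add {n : ℕ} (π : Equiv.Perm (Fin n)) :
    2 * numLeftPeaks π + wordDoubleAscents (permWord ⊤ π) n +
      wordDoubleDescents (permWord ⊤ π) n = n := by
  have h := two_mul_wordPeaks_add (f := permWord ⊤ π) (n := n)
    fun j hj => permWord_ne_succ ⊤ π (Or.inr rfl) hj
  have hlast : permWord ⊤ π n < permWord ⊤ π (n + 1) := by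
    rw [permWord_of_gt ⊤ π (Nat.lt_succ_self n), permWord_of_le ⊤ π le_rfl]
    exact WithTop.coe_lt_top _
  rw [if_pos (permWord_zero_lt_one ⊤ π (Or.inr WithTop.top_pos)), if_pos hlast,
    wordPeaks_permWord_top] at h
  omega

/-- With weight `0` for double descents, a permutation without them is weighted by its number of
peaks alone, and every other permutation vanishes. -/
theorem wordWeight_permWord_zero {n : ℕ} (hn : 1 ≤ n) (u s : ℝ) (π : Equiv.Perm (Fin n)) :
    wordWeight u s 0 (permWord 0 π) n =
      if numDoubleDescents π = 0 then u ^ numPeaks π * s ^ (n + 1 - 2 * numPeaks π) else 0 := by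
  have h := two_mul_numPeaks_add hn π
  rw [wordWeight_eq, wordPeaks_permWord_zero, wordDoubleDescents_permWord_zero hn]
  split_ifs with hd
  · rw [hd, pow_zero, mul_one]
    congr 2
    omega
  · rw [zero_pow hd, mul_zero]

theorem wordWeight_permWord_top {A : Type*} [CommMonoid A] {n : ℕ} (u s : A)
    (π : Equiv.Perm (Fin n)) :
    wordWeight u s s (permWord ⊤ π) n = u ^ numLeftPeaks π * s ^ (n - 2 * numLeftPeaks π) := by
  have h := two_mul_numLeftPeaks_add π
  rw [wordWeight_eq, wordPeaks_permWord_top, mul_assoc, ← pow_add]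
  congr 2
  omega

theorem altTanPoly_eq_sum_peakCount {n : ℕ} (hn : 1 ≤ n) :
    altTanPoly n = ∑ k ∈ Finset.Icc 1 ((n + 1) / 2),
      (peakCount n k : ℝ[X]) * (X ^ 2 - 1) ^ k * (2 * X) ^ (n + 1 - 2 * k) := by
  refine Polynomial.funext fun a => ?_
  -- At the point `a`, the free parameter `a` makes the weight of double descents vanish.
  have key : (altTanPoly n).eval a = ∑ π : Equiv.Perm (Fin n),
      if numDoubleDescents π = 0 then
        (a ^ 2 - 1) ^ numPeaks π * (2 * a) ^ (n + 1 - 2 * numPeaks π) else 0 := by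
    obtain ⟨m, rfl⟩ := Nat.exists_eq_add_of_le' hn
    rw [altTanPoly_eq_sum_wordWeight a m, eval_finsetSum]
    refine Finset.sum_congr rfl fun π _ => ?_
    rw [eval_wordWeight, ← wordWeight_permWord_zero hn]
    simp [two_mul]
  have hmem : ∀ π ∈ (Finset.univ : Finset (Equiv.Perm (Fin n))),
      numPeaks π ∈ Finset.Icc 1 ((n + 1) / 2) := fun π _ => by
    have h := two_mul_numPeaks_add hn π
    exact Finset.mem_Icc.2 ⟨one_le_numPeaks hn π, by omega⟩
  rw [key, ← Finset.sum_fiberwise_of_maps_to hmem, eval_finsetSum]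
  refine Finset.sum_congr rfl fun k _ => ?_
  rw [← Finset.sum_filter, Finset.filter_filter,
    Finset.sum_congr rfl (g := fun _ => (a ^ 2 - 1) ^ k * (2 * a) ^ (n + 1 - 2 * k))
      fun π hπ => by rw [(Finset.mem_filter.1 hπ).2.1],
    Finset.sum_const, nsmul_eq_mul]
  simp [peakCount, mul_assoc]

theorem altSecPoly_eq_sum_leftPeakCount (n : ℕ) :
    altSecPoly n = ∑ k ∈ Finset.range (n / 2 + 1),
      4 ^ k * (leftPeakCount n k : ℝ[X]) * (X ^ 2 - 1) ^ k * (2 * X) ^ (n - 2 * k) := by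
  have hmem : ∀ π ∈ (Finset.univ : Finset (Equiv.Perm (Fin n))),
      numLeftPeaks π ∈ Finset.range (n / 2 + 1) := fun π _ => by
    have h := two_mul_numLeftPeaks_add π
    exact Finset.mem_range.2 (by omega)
  simp only [altSecPoly_eq_sum_wordWeight, wordWeight_permWord_top]
  rw [← Finset.sum_fiberwise_of_maps_to' hmem
    fun k => (4 * (X ^ 2 - 1) : ℝ[X]) ^ k * (2 * X) ^ (n - 2 * k)]
  refine Finset.sum_congr rfl fun k _ => ?_
  rw [Finset.sum_const, nsmul_eq_mul, leftPeakCount, mul_pow 4]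
  ring

theorem corollary3p4 (n : ℕ) (hn : 1 ≤ n) :
    altTanPoly n =
        ∑ k ∈ Finset.Icc 1 ((n + 1) / 2),
          (peakCount n k : ℝ[X]) * (X ^ 2 - 1) ^ k * (2 * X) ^ (n + 1 - 2 * k) ∧
      altSecPoly n =
        ∑ k ∈ Finset.range (n / 2 + 1),
          4 ^ k * (leftPeakCount n k : ℝ[X]) * (X ^ 2 - 1) ^ k * (2 * X) ^ (n - 2 * k) := 
  ⟨altTanPoly_eq_sum_peakCount hn, altSecPoly_eq_sum_leftPeakCount n⟩
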